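/- Let $n$ and $N$ be integers with $n+1 < N < 2n$, and let $S^{n-1}$ denote the unit sphere in $\mathbb{R}^n$. Then there is no $N$-point universally optimal configuration on $S^{n-1}$. Here a $C^\infty$ function $f\colon (0,4]\to\mathbb{R}$ is called completely monotonic if $(-1)^k f^{(k)}(r)\ge 0$ for all $r\in(0,4]$ and all integers $k\ge 0$ (with one-sided derivatives at $r=4$), and a finite subset $\mathcal{C}\subset S^{n-1}$ is called universally optimal if, for every completely monotonic $f\colon(0,4]\to\mathbb{R}$ and every subset $\mathcal{C}'\subset S^{n-1}$ with $|\mathcal{C}'|=|\mathcal{C}|$, $$\sum_{x,y\in\mathcal{C},\ x\neq y} f\big(|x-y|^2\big)\ \le\ \sum_{x,y\in\mathcal{C}',\ x\neq y} f\big(|x-y|^2\big).$$ -/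

import Mathlib

open scoped ContDiff

/-- `f` is completely monotonic on the (nondegenerate) interval `I`: it is smooth on `I` and
`(-1)^k f^{(k)} ≥ 0` on `I` for all `k ≥ 0`, derivatives at endpoints being one-sided. -/
def CompletelyMonotonicOn (f : ℝ → ℝ) (I : Set ℝ) : Prop :=
  ContDiffOn ℝ ∞ f I ∧ ∀ k : ℕ, ∀ x ∈ I, 0 ≤ (-1 : ℝ) ^ k * iteratedDerivWithin k f I x

open Classical in
/-- The potential energy of a finite configuration `C`: the sum of `f (|x - y|^2)` over all
ordered pairs of distinct points `x, y` of `C`. -/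
noncomputable def potentialEnergy {n : ℕ} (f : ℝ → ℝ)
    (C : Finset (EuclideanSpace ℝ (Fin n))) : ℝ :=
  ∑ p ∈ C.offDiag, f (‖p.1 - p.2‖ ^ 2)

/-- `C` is a universally optimal subset of the unit sphere `S^{n-1}` of `ℝ^n`: for every
completely monotonic `f` on `(0, 4]`, it minimizes the energy among all subsets of the sphere
of the same cardinality. (Values of `f` outside `(0, 4]` never enter.) -/
def IsUniversallyOptimal {n : ℕ} (C : Finset (EuclideanSpace ℝ (Fin n))) : Prop :=
  (C : Set (EuclideanSpace ℝ (Fin n))) ⊆ Metric.sphere 0 1 ∧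
    ∀ f : ℝ → ℝ, CompletelyMonotonicOn f (Set.Ioc 0 4) →
      ∀ C' : Finset (EuclideanSpace ℝ (Fin n)),
        (C' : Set (EuclideanSpace ℝ (Fin n))) ⊆ Metric.sphere 0 1 →
        C'.card = C.card → potentialEnergy f C ≤ potentialEnergy f C'

/-!
A universally optimal configuration minimizes the energies of all Gaussians `r ↦ exp (-c * r)`,
that is, the sums of `exp (2 * c * ⟨x, y⟩)` over pairs of distinct points. As `c → ∞` this forces
all inner products to be nonpositive and makes the number of orthogonal pairs as small as it can
be made, even asymptotically, by other configurations. The proof plays off two bounds on that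
number. Write `N = n + k` and `n = k + s`, so that `k ≥ 2` and `s > 0`.

Lower bound (`card_le_and_le_card_orthogonalPairs`): vectors with pairwise nonpositive inner
products split into mutually orthogonal circuits and an independent rest, because a minimal linear
dependency among them has coefficients of one sign, so that its support is orthogonal to all other
vectors. Since `N > n` there are at least `k` circuits, and this gives at least `4 * (k - 1) * n`
ordered orthogonal pairs.

Upper bound (`exists_competitor`,
`IsUniversallyOptimal.inner_nonpos_and_card_orthogonalPairs_le`): take `k` antipodal pairs on
coordinate axes and, in the remaining `s` dimensions, `s` fixed points at strictly obtuse angles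
to each other and acute angles to a vector `w`. Bending the antipodal pairs away from `w` by `h`
makes their inner products with the fixed points negative of order `h`, while the inner products
between different antipodal pairs become only `h ^ 2`. For `1 / c ≪ h ≪ c ^ (-1/2)` only the
`4 * k * (k - 1)` latter pairs count. As `k < n`, the two bounds contradict each other.
-/

/-! ### Orthogonal pairs in sets with nonpositive inner products -/

section ObtuseSets

variable {E : Type*} [NormedAddCommGroup E] [InnerProductSpace ℝ E]

/-- A minimal linearly dependent subset of a set of vectors with pairwise nonpositive inner products
carries a relation with all coefficients positive. -/
theorem exists_pos_relation_of_minimal {A : Finset E}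
    (hA : ∀ x ∈ A, ∀ y ∈ A, x ≠ y → inner ℝ x y ≤ 0)
    (hdep : ¬ LinearIndepOn ℝ id (A : Set E))
    (hmin : ∀ B ⊂ A, LinearIndepOn ℝ id (B : Set E)) :
    ∃ g : E → ℝ, (∀ x ∈ A, 0 < g x) ∧ ∑ x ∈ A, g x • x = 0 := by
  classical
  obtain ⟨g, hg, z, hzA, hz⟩ : ∃ g : E → ℝ, ∑ x ∈ A, g x • x = 0 ∧ ∃ z ∈ A, 0 < g z := by
    rw [linearIndepOn_finset_iff] at hdep
    push Not at hdep
    obtain ⟨g, hg, z, hzA, hz⟩ := hdep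
    rcases hz.lt_or_gt with h | h
    · refine ⟨fun x => - g x, ?_, z, hzA, by simpa using h⟩
      simpa [neg_smul, Finset.sum_neg_distrib] using hg
    · exact ⟨g, hg, z, hzA, h⟩
  set P := A.filter (fun x => 0 < g x) with hP
  set M := A.filter (fun x => ¬ 0 < g x) with hM
  have hsplit : ∑ x ∈ P, g x • x + ∑ x ∈ M, g x • x = 0 := by
    rw [hP, hM, Finset.sum_filter_add_sum_filter_not, hg]
  -- The positive part `v` of the relation is orthogonal to itself.
  have hv : ∑ x ∈ P, g x • x = 0 := by
    have h1 : ∑ x ∈ P, g x • x = - ∑ y ∈ M, g y • y := eq_neg_of_add_eq_zero_left hsplit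
    have h2 : inner ℝ (∑ x ∈ P, g x • x) (∑ x ∈ P, g x • x) ≤ 0 := by
      conv_lhs => arg 3; rw [h1]
      rw [inner_neg_right, sum_inner, neg_nonpos]
      refine Finset.sum_nonneg fun x hx => ?_
      rw [inner_sum]
      refine Finset.sum_nonneg fun y hy => ?_
      rw [real_inner_smul_left, real_inner_smul_right]
      simp only [hP, hM, Finset.mem_filter, not_lt] at hx hy
      have hxy : inner ℝ x y ≤ 0 := hA x hx.1 y hy.1 (by
        rintro rfl
        exact absurd hx.2 (not_lt.2 hy.2))
      exact mul_nonneg hx.2.le (mul_nonneg_of_nonpos_of_nonpos hy.2 hxy)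
    exact inner_self_eq_zero.1 (le_antisymm h2 real_inner_self_nonneg)
  have hPA : P = A := by
    by_contra hne
    have hss : P ⊂ A := (Finset.filter_subset _ _).ssubset_of_ne hne
    have := linearIndepOn_finset_iff.1 (hmin P hss) g hv z (Finset.mem_filter.2 ⟨hzA, hz⟩)
    exact hz.ne' this
  refine ⟨g, fun x hx => ?_, hg⟩
  rw [← hPA] at hx
  exact (Finset.mem_filter.1 hx).2

/-- A linearly dependent set of vectors with pairwise nonpositive inner products contains a circuit
(a dependent set with an independent subset of one element less) that is orthogonal to
all the remaining vectors. -/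
theorem exists_orthogonal_circuit {C : Finset E}
    (hC : ∀ x ∈ C, ∀ y ∈ C, x ≠ y → inner ℝ x y ≤ 0)
    (hdep : ¬ LinearIndepOn ℝ id (C : Set E)) :
    ∃ A ⊆ C, ∃ B ⊆ A, A.card = B.card + 1 ∧ LinearIndepOn ℝ id (B : Set E) ∧
      ¬ LinearIndepOn ℝ id (A : Set E) ∧ ∀ x ∈ A, ∀ y ∈ C, y ∉ A → inner ℝ x y = 0 := by
  classical
  obtain ⟨A, hAC, hA⟩ := Finset.exists_le_minimal
    (C.powerset.filter fun A => ¬ LinearIndepOn ℝ id (A : Set E)) (a := C) (by simpa using hdep)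
  have hAC : A ⊆ C := hAC
  have hAdep : ¬ LinearIndepOn ℝ id (A : Set E) := (Finset.mem_filter.1 hA.1).2
  have hmin : ∀ B ⊂ A, LinearIndepOn ℝ id (B : Set E) := by
    intro B hB
    by_contra h
    exact hB.2 (hA.2 (y := B)
      (Finset.mem_filter.2 ⟨Finset.mem_powerset.2 (hB.1.trans hAC), h⟩) hB.1)
  obtain ⟨g, hgpos, hg⟩ := exists_pos_relation_of_minimal
    (fun x hx y hy => hC x (hAC hx) y (hAC hy)) hAdep hmin
  obtain ⟨z, hz⟩ : A.Nonempty := by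
    rw [Finset.nonempty_iff_ne_empty]
    rintro rfl
    exact hAdep (by simp)
  refine ⟨A, hAC, A.erase z, Finset.erase_subset _ _, (Finset.card_erase_add_one hz).symm,
    hmin _ (Finset.erase_ssubset hz), hAdep, fun x hx y hy hyA => ?_⟩
  have h0 : ∑ x ∈ A, g x * inner ℝ x y = 0 := by
    have : inner ℝ (∑ x ∈ A, g x • x) y = 0 := by rw [hg, inner_zero_left]
    simpa [sum_inner, real_inner_smul_left] using this
  have hle : ∀ x ∈ A, g x * inner ℝ x y ≤ 0 := fun x hx =>
    mul_nonpos_of_nonneg_of_nonpos (hgpos x hx).le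
      (hC x (hAC hx) y hy (by rintro rfl; exact hyA hx))
  exact (mul_eq_zero.1 ((Finset.sum_eq_zero_iff_of_nonpos hle).1 h0 x hx)).resolve_left
    (hgpos x hx).ne'

open Classical in
/-- The ordered pairs of distinct orthogonal points of `C`. -/
noncomputable def orthogonalPairs (C : Finset E) : Finset (E × E) :=
  C.offDiag.filter fun p => inner ℝ p.1 p.2 = 0

open Classical in
theorem card_orthogonalPairs_add_le {A C : Finset E} (hAC : A ⊆ C)
    (horth : ∀ x ∈ A, ∀ y ∈ C, y ∉ A → inner ℝ x y = 0) :
    2 * (A.card * (C \ A).card) + (orthogonalPairs (C \ A)).card ≤ (orthogonalPairs C).card := by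
  have hsub : (A ×ˢ (C \ A) ∪ (C \ A) ×ˢ A) ∪ orthogonalPairs (C \ A) ⊆ orthogonalPairs C := by
    rintro ⟨x, y⟩ h
    simp only [orthogonalPairs, Finset.mem_union, Finset.mem_product, Finset.mem_sdiff,
      Finset.mem_filter, Finset.mem_offDiag] at h ⊢
    rcases h with (⟨hx, hy, hyA⟩ | ⟨⟨hx, hxA⟩, hy⟩) | ⟨⟨⟨hx, -⟩, ⟨hy, -⟩, hne⟩, h0⟩
    · exact ⟨⟨hAC hx, hy, by rintro rfl; exact hyA hx⟩, horth x hx y hy hyA⟩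
    · exact ⟨⟨hx, hAC hy, by rintro rfl; exact hxA hy⟩, by
        rw [real_inner_comm]; exact horth y hy x hx hxA⟩
    · exact ⟨⟨hx, hy, hne⟩, h0⟩
  have h1 : Disjoint (A ×ˢ (C \ A)) ((C \ A) ×ˢ A) := by
    rw [Finset.disjoint_left]
    rintro ⟨x, y⟩ h h'
    simp only [Finset.mem_product, Finset.mem_sdiff] at h h'
    exact h'.1.2 h.1
  have h2 : Disjoint (A ×ˢ (C \ A) ∪ (C \ A) ×ˢ A) (orthogonalPairs (C \ A)) := by
    rw [Finset.disjoint_left]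
    rintro ⟨x, y⟩ h h'
    simp only [orthogonalPairs, Finset.mem_union, Finset.mem_product, Finset.mem_sdiff,
      Finset.mem_filter, Finset.mem_offDiag] at h h'
    tauto
  calc _ = _ := by
        rw [Finset.card_union_of_disjoint h2, Finset.card_union_of_disjoint h1,
          Finset.card_product, Finset.card_product]
        ring
    _ ≤ _ := Finset.card_le_card hsub

/-- Nonzero vectors with pairwise nonpositive inner products in a space of dimension `d`: there are
at most `2 * d` of them, and `m` of them form at least `4 * (m - d - 1) * d` ordered orthogonal
pairs. Both bounds follow by splitting off one orthogonal circuit at a time. -/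
theorem card_le_and_le_card_orthogonalPairs (V : Submodule ℝ E) [FiniteDimensional ℝ V]
    (C : Finset E) (hCV : (C : Set E) ⊆ V) (h0 : (0 : E) ∉ C)
    (hC : ∀ x ∈ C, ∀ y ∈ C, x ≠ y → inner ℝ x y ≤ 0) :
    C.card ≤ 2 * Module.finrank ℝ V ∧
      4 * ((C.card : ℤ) - Module.finrank ℝ V - 1) * Module.finrank ℝ V ≤
        (orthogonalPairs C).card := by
  classical
  induction hm : C.card using Nat.strong_induction_on generalizing V C with
  | _ m ih =>
  set d := Module.finrank ℝ V with hd
  rcases le_or_gt m d with hmd | hmd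
  · refine ⟨by omega, le_trans ?_ (Int.natCast_nonneg _)⟩
    have h1 : (m : ℤ) ≤ d := by exact_mod_cast hmd
    have h2 : (0 : ℤ) ≤ d := Int.natCast_nonneg _
    nlinarith
  have hdep : ¬ LinearIndepOn ℝ id (C : Set E) := by
    intro h
    have h1 := finrank_span_finset_eq_card h
    have h2 := Submodule.finrank_mono (Submodule.span_le.2 hCV)
    omega
  obtain ⟨A, hAC, B, hBA, hcard, hB, hAdep, horth⟩ := exists_orthogonal_circuit hC hdep
  have hB1 : 1 ≤ B.card := by
    by_contra hlt
    have hA1 : A.card = 1 := by omega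
    obtain ⟨a, rfl⟩ := Finset.card_eq_one.1 hA1
    refine hAdep ?_
    have ha : a ≠ 0 := by
      rintro rfl
      exact h0 (hAC (Finset.mem_singleton_self _))
    simpa [linearIndepOn_singleton_iff] using ha
  have hBV : Submodule.span ℝ (B : Set E) ≤ V :=
    Submodule.span_le.2 fun x hx => hCV (hAC (hBA hx))
  have hfin := Submodule.finrank_add_inf_finrank_orthogonal hBV
  rw [finrank_span_finset_eq_card hB, ← hd] at hfin
  set W := (Submodule.span ℝ (B : Set E))ᗮ ⊓ V with hW
  have hcard' : (C \ A).card + A.card = m := by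
    rw [Finset.card_sdiff_add_card_eq_card hAC, hm]
  have : FiniteDimensional ℝ W := Submodule.finiteDimensional_of_le (inf_le_right : W ≤ V)
  obtain ⟨ih1, ih2⟩ := ih (C \ A).card (by omega) W (C \ A)
    (by
      intro y hy
      simp only [Finset.coe_sdiff, Set.mem_sdiff, Finset.mem_coe] at hy
      refine ⟨?_, hCV hy.1⟩
      rw [SetLike.mem_coe, Submodule.mem_orthogonal]
      intro u hu
      induction hu using Submodule.span_induction with
      | mem x hx => exact horth x (hBA hx) y hy.1 hy.2
      | zero => exact inner_zero_left _
      | add u v _ _ hu hv => rw [inner_add_left, hu, hv, add_zero]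
      | smul c u _ hu => rw [real_inner_smul_left, hu, mul_zero])
    (fun h => h0 (Finset.mem_sdiff.1 h).1)
    (fun x hx y hy => hC x (Finset.mem_sdiff.1 hx).1 y (Finset.mem_sdiff.1 hy).1) rfl
  have hpairs := card_orthogonalPairs_add_le hAC horth
  refine ⟨by omega, ?_⟩
  generalize (C \ A).card = m' at *
  generalize Module.finrank ℝ W = e at *
  zify at hpairs hcard' hfin hcard ih1 hB1
  refine le_trans ?_ hpairs
  refine le_trans ?_ (add_le_add_right ih2 _)
  rw [← hfin, ← hcard', hcard]
  nlinarith [mul_nonneg (sub_nonneg.2 hB1) (sub_nonneg.2 ih1)]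

end ObtuseSets

/-! ### Gaussian energies -/

section Energy

theorem completelyMonotonicOn_exp_neg_mul {c : ℝ} (hc : 0 ≤ c) :
    CompletelyMonotonicOn (fun r => Real.exp (-c * r)) (Set.Ioc 0 4) := by
  have hsm : ContDiff ℝ ∞ (fun r : ℝ => Real.exp (-c * r)) :=
    Real.contDiff_exp.comp (contDiff_const.mul contDiff_id)
  refine ⟨hsm.contDiffOn, fun k x hx => ?_⟩
  rw [iteratedDerivWithin_eq_iteratedDeriv (uniqueDiffOn_Ioc 0 4)
    ((hsm.of_le (by exact_mod_cast le_top)).contDiffAt) hx, iteratedDeriv_exp_const_mul]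
  rw [← mul_assoc, ← mul_pow]
  have : (-1 : ℝ) * -c = c := by ring
  rw [this]
  positivity

open Classical in
/-- On the unit sphere `|x - y|^2 = 2 - 2⟨x, y⟩`, so Gaussian energies are sums of
exponentials of inner products. -/
theorem potentialEnergy_exp_neg_mul {n : ℕ} (c : ℝ) {C : Finset (EuclideanSpace ℝ (Fin n))}
    (hC : (C : Set (EuclideanSpace ℝ (Fin n))) ⊆ Metric.sphere 0 1) :
    potentialEnergy (fun r => Real.exp (-c * r)) C =
      Real.exp (-2 * c) * ∑ p ∈ C.offDiag, Real.exp (2 * c * inner ℝ p.1 p.2) := by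
  rw [potentialEnergy, Finset.mul_sum]
  refine Finset.sum_congr rfl fun p hp => ?_
  rw [Finset.mem_offDiag] at hp
  have h1 : ‖p.1‖ = 1 := by simpa using hC hp.1
  have h2 : ‖p.2‖ = 1 := by simpa using hC hp.2.1
  rw [← Real.exp_add, norm_sub_sq_real, h1, h2]
  congr 1
  ring

open Classical in
theorem IsUniversallyOptimal.sum_exp_le {n : ℕ} {C C' : Finset (EuclideanSpace ℝ (Fin n))}
    (hC : IsUniversallyOptimal C)
    (hC' : (C' : Set (EuclideanSpace ℝ (Fin n))) ⊆ Metric.sphere 0 1)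
    (hcard : C'.card = C.card) {c : ℝ} (hc : 0 ≤ c) :
    ∑ p ∈ C.offDiag, Real.exp (2 * c * inner ℝ p.1 p.2) ≤
      ∑ p ∈ C'.offDiag, Real.exp (2 * c * inner ℝ p.1 p.2) := by
  have h := hC.2 _ (completelyMonotonicOn_exp_neg_mul hc) C' hC' hcard
  rw [potentialEnergy_exp_neg_mul c hC.1, potentialEnergy_exp_neg_mul c hC'] at h
  exact le_of_mul_le_mul_left h (Real.exp_pos _)

end Energy

/-! ### Competing configurations with few orthogonal pairs -/

section Competitor

variable {E : Type*} [NormedAddCommGroup E] [InnerProductSpace ℝ E]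

/-- In a space with an orthonormal basis of `s` elements there are `s` unit vectors at pairwise
obtuse angles, all at acute angles to one further unit vector `w`. -/
theorem exists_strictly_obtuse {s : ℕ} (hs : 0 < s) {e : Fin s → E} (he : Orthonormal ℝ e) :
    ∃ δ : ℝ, 0 < δ ∧ ∃ (b : Fin s → E) (w : E), ‖w‖ = 1 ∧ (∀ j, ‖b j‖ = 1) ∧
      (∀ j l, j ≠ l → inner ℝ (b j) (b l) ≤ -δ) ∧ (∀ j, δ ≤ inner ℝ (b j) w) ∧
      ∀ x, (∀ j, inner ℝ x (e j) = 0) → inner ℝ x w = 0 ∧ ∀ j, inner ℝ x (b j) = 0 := by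
  have hs' : (0 : ℝ) < s := by exact_mod_cast hs
  have hs1 : (1 : ℝ) ≤ s := by exact_mod_cast hs
  set u : E := ∑ i, e i with hu
  have heu : ∀ j, inner ℝ (e j) u = 1 := by
    intro j
    rw [hu, inner_sum]
    simp [orthonormal_iff_ite.1 he]
  have hue : ∀ j, inner ℝ u (e j) = 1 := fun j => by rw [real_inner_comm, heu]
  have huu : inner ℝ u u = (s : ℝ) := by
    conv_lhs => arg 2; rw [hu]
    rw [sum_inner]
    simp [heu]
  -- Subtracting a multiple of `u` makes the angles obtuse; half of the multiple orthogonal to `u`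
  -- is taken, so that the inner products with `u` stay positive.
  set v : Fin s → E := fun j => e j - (1 / (2 * s) : ℝ) • u with hv
  have hvv : ∀ j l, inner ℝ (v j) (v l) = inner ℝ (e j) (e l) - 3 / (4 * s) := by
    intro j l
    simp only [hv, inner_sub_left, inner_sub_right, real_inner_smul_left, real_inner_smul_right,
      heu, hue, huu]
    field_simp
    ring
  have hvu : ∀ j, inner ℝ (v j) u = 1 / 2 := by
    intro j
    simp only [hv, inner_sub_left, real_inner_smul_left, heu, huu]
    field_simp
    ring
  set q : ℝ := Real.sqrt (1 - 3 / (4 * s)) with hq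
  have hqpos' : (0 : ℝ) < 1 - 3 / (4 * s) := by
    rw [sub_pos, div_lt_one (by positivity)]
    linarith
  have hqpos : 0 < q := Real.sqrt_pos.2 hqpos'
  have hnv : ∀ j, ‖v j‖ = q := by
    intro j
    rw [hq, ← Real.sqrt_sq (norm_nonneg (v j)), ← real_inner_self_eq_norm_sq, hvv,
      real_inner_self_eq_norm_sq, he.1 j]
    norm_num
  have hsq : 0 < Real.sqrt s := Real.sqrt_pos.2 hs'
  have hnu : ‖u‖ = Real.sqrt s := by
    rw [← Real.sqrt_sq (norm_nonneg u), ← real_inner_self_eq_norm_sq, huu]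
  have hd1 : 0 < q⁻¹ * (q⁻¹ * (3 / (4 * s))) := by positivity
  have hd2 : 0 < q⁻¹ * ((Real.sqrt s)⁻¹ * (1 / 2)) := by positivity
  refine ⟨min (q⁻¹ * (q⁻¹ * (3 / (4 * s)))) (q⁻¹ * ((Real.sqrt s)⁻¹ * (1 / 2))),
    lt_min hd1 hd2, fun j => q⁻¹ • v j, (Real.sqrt s)⁻¹ • u, ?_, ?_, ?_, ?_, ?_⟩
  · rw [norm_smul, hnu, norm_inv, Real.norm_of_nonneg hsq.le, inv_mul_cancel₀ hsq.ne']
  · intro j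
    rw [norm_smul, hnv, norm_inv, Real.norm_of_nonneg hqpos.le, inv_mul_cancel₀ hqpos.ne']
  · intro j l hjl
    rw [real_inner_smul_left, real_inner_smul_right, hvv, he.2 hjl]
    have := min_le_left (q⁻¹ * (q⁻¹ * (3 / (4 * s)))) (q⁻¹ * ((Real.sqrt s)⁻¹ * (1 / 2)))
    linarith
  · intro j
    rw [real_inner_smul_left, real_inner_smul_right, hvu]
    exact min_le_right _ _
  · intro x hx
    have hxu : inner ℝ x u = 0 := by rw [hu, inner_sum]; simp [hx]
    refine ⟨by rw [real_inner_smul_right, hxu, mul_zero], fun j => ?_⟩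
    simp [hv, real_inner_smul_right, inner_sub_right, hx, hxu]

/-- The pairs of indices belonging to different antipodal pairs. -/
def crossRel {k s : ℕ} : (Fin k × Bool) ⊕ Fin s → (Fin k × Bool) ⊕ Fin s → Prop
  | .inl a, .inl b => a.1 ≠ b.1
  | _, _ => False

theorem crossRel_inl_inl {k s : ℕ} (a b : Fin k × Bool) :
    crossRel (.inl a : (Fin k × Bool) ⊕ Fin s) (.inl b) ↔ a.1 ≠ b.1 := by
  simp [crossRel]

theorem not_crossRel_inl_inr {k s : ℕ} (a : Fin k × Bool) (j : Fin s) :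
    ¬ crossRel (.inl a) (.inr j) := by
  simp [crossRel]

theorem not_crossRel_inr {k s : ℕ} (j : Fin s) (x : (Fin k × Bool) ⊕ Fin s) :
    ¬ crossRel (.inr j) x := by
  simp [crossRel]

open Classical in
theorem sum_crossRel (k s : ℕ) :
    ∑ x : (Fin k × Bool) ⊕ Fin s, ∑ y : (Fin k × Bool) ⊕ Fin s,
      (if crossRel x y then (1 : ℝ) else 0) = 4 * k * (k - 1) := by
  have h : ∀ i : Fin k, ∑ j : Fin k, (if i ≠ j then (1 : ℝ) else 0) = k - 1 := by
    intro i
    have : ∀ j : Fin k, (if i ≠ j then (1 : ℝ) else 0) = 1 - if i = j then 1 else 0 := by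
      intro j
      split_ifs <;> simp_all
    simp [this]
  simp only [Fintype.sum_sum_type, crossRel_inl_inl, not_crossRel_inl_inr, not_crossRel_inr,
    Fintype.sum_prod_type, Fintype.sum_bool, h,
    Finset.sum_add_distrib, if_false, Finset.sum_const_zero, add_zero, Finset.sum_const,
    Finset.card_univ, Fintype.card_prod, Fintype.card_bool, Fintype.card_fin, nsmul_eq_mul]
  push_cast
  ring

/-- Points of the competing configuration: the antipodal pairs `±a i` bent away from `w`
by the amount `h`, together with the fixed points `b j`. -/
noncomputable def bentPoint {k s : ℕ} (a : Fin k → E) (b : Fin s → E) (w : E) (h : ℝ) :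
    (Fin k × Bool) ⊕ Fin s → E
  | .inl (i, σ) => ((if σ then 1 else -1) * Real.sqrt (1 - h ^ 2)) • a i - h • w
  | .inr j => b j

open Classical in
/-- For `k + s` orthonormal vectors there are unit configurations of `2 * k + s` points, depending
on `h`, in which only `4 * k * (k - 1)` ordered pairs of points have an inner product as large as
`h ^ 2`, while all the other inner products are at most `-h * δ`. -/
theorem exists_competitor {k s : ℕ} (hs : 0 < s) {e : Fin k ⊕ Fin s → E} (he : Orthonormal ℝ e) :
    ∃ δ : ℝ, 0 < δ ∧ ∀ h : ℝ, 0 < h → h ≤ 1 / 2 → ∃ C : Finset E, C.card = 2 * k + s ∧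
      (C : Set E) ⊆ Metric.sphere 0 1 ∧ ∀ c : ℝ, 0 ≤ c →
        ∑ p ∈ C.offDiag, Real.exp (2 * c * inner ℝ p.1 p.2) ≤
          4 * k * (k - 1) * Real.exp (2 * c * h ^ 2) +
            (2 * k + s) ^ 2 * Real.exp (2 * c * (-(h * δ))) := by
  obtain ⟨δ₀, hδ₀, b, w, hw, hb, hbb, hbw, hperp⟩ :=
    exists_strictly_obtuse hs (he.comp Sum.inr Sum.inr_injective)
  set a : Fin k → E := fun i => e (Sum.inl i) with ha
  have haa : ∀ i j, inner ℝ (a i) (a j) = if i = j then (1 : ℝ) else 0 := by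
    intro i j
    simp [ha, orthonormal_iff_ite.1 he]
  have hperp' : ∀ i, inner ℝ (a i) w = 0 ∧ ∀ j, inner ℝ (a i) (b j) = 0 := fun i =>
    hperp (a i) fun j => he.2 (by simp)
  have haw : ∀ i, inner ℝ (a i) w = 0 := fun i => (hperp' i).1
  have hwa : ∀ i, inner ℝ w (a i) = 0 := fun i => by rw [real_inner_comm, haw]
  have hab : ∀ i j, inner ℝ (a i) (b j) = 0 := fun i => (hperp' i).2
  have hww : inner ℝ w w = (1 : ℝ) := by rw [real_inner_self_eq_norm_sq, hw, one_pow]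
  refine ⟨min δ₀ 1, lt_min hδ₀ one_pos, fun h hpos hhalf => ?_⟩
  have hδ1 : min δ₀ 1 ≤ 1 := min_le_right _ _
  have hδ2 : min δ₀ 1 ≤ δ₀ := min_le_left _ _
  have hδ3 : 0 < min δ₀ 1 := lt_min hδ₀ one_pos
  generalize min δ₀ 1 = δ at *
  have hsq : Real.sqrt (1 - h ^ 2) ^ 2 = 1 - h ^ 2 := Real.sq_sqrt (by nlinarith)
  set p := bentPoint a b w h with hp
  have hinner : ∀ i σ j τ, inner ℝ (p (.inl (i, σ))) (p (.inl (j, τ))) =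
      (if σ then 1 else -1) * (if τ then 1 else -1) * (1 - h ^ 2) * (if i = j then 1 else 0)
        + h ^ 2 := by
    intro i σ j τ
    rw [← hsq]
    simp only [hp, bentPoint, inner_sub_left, inner_sub_right, real_inner_smul_left,
      real_inner_smul_right, haw, hwa, hww, haa]
    ring
  have hub : ∀ i σ j, inner ℝ (p (.inl (i, σ))) (p (.inr j)) ≤ -(h * δ) := by
    intro i σ j
    have := hbw j
    rw [real_inner_comm] at this
    simp only [hp, bentPoint, inner_sub_left, real_inner_smul_left, hab]
    nlinarith
  have hnorm : ∀ x, ‖p x‖ = 1 := by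
    rintro (⟨i, σ⟩ | j)
    · have h1 := hinner i σ i σ
      rw [real_inner_self_eq_norm_sq] at h1
      have h2 : ‖p (.inl (i, σ))‖ ^ 2 = 1 := by rw [h1]; cases σ <;> simp
      exact (pow_eq_one_iff_of_nonneg (norm_nonneg _) two_ne_zero).1 h2
    · exact hb j
  have hbound : ∀ x y, x ≠ y →
      inner ℝ (p x) (p y) ≤ if crossRel x y then h ^ 2 else -(h * δ) := by
    rintro (⟨i, σ⟩ | j) (⟨i', σ'⟩ | j') hne
    · rw [hinner]
      by_cases hii : i = i'
      · subst hii
        have hσ : σ ≠ σ' := by rintro rfl; exact hne rfl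
        have : ((if σ then 1 else -1) * (if σ' then 1 else -1) : ℝ) = -1 := by
          cases σ <;> cases σ' <;> simp_all
        rw [this]
        simp only [crossRel_inl_inl, ne_eq, not_true_eq_false, if_false, if_true]
        nlinarith
      · simp [crossRel, hii]
    · simpa [crossRel] using hub i σ j'
    · rw [real_inner_comm]
      simpa [crossRel] using hub i' σ' j
    · have hjj : j ≠ j' := by rintro rfl; exact hne rfl
      have := hbb j j' hjj
      rw [if_neg (not_crossRel_inr _ _)]
      change inner ℝ (b j) (b j') ≤ _
      nlinarith
  have hinj : Function.Injective p := by
    intro x y hxy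
    by_contra hne
    have h1 := hbound x y hne
    rw [hxy, real_inner_self_eq_norm_sq, hnorm] at h1
    split_ifs at h1 <;> nlinarith
  refine ⟨Finset.univ.image p, ?_, ?_, fun c hc => ?_⟩
  · rw [Finset.card_image_of_injective _ hinj]
    simp [mul_comm]
  · intro x hx
    simp only [Finset.coe_image, Finset.coe_univ, Set.image_univ, Set.mem_range] at hx
    obtain ⟨y, rfl⟩ := hx
    simpa using hnorm y
  · have hoff : (Finset.univ.image p).offDiag =
        (Finset.univ.offDiag).image (Prod.map p p) := by
      ext ⟨x, y⟩
      simp only [Finset.mem_offDiag, Finset.mem_image, Finset.mem_univ, true_and, Prod.exists,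
        Prod.map_apply, Prod.mk.injEq]
      constructor
      · rintro ⟨⟨i, rfl⟩, ⟨j, rfl⟩, hne⟩
        exact ⟨i, j, fun hij => hne (by rw [hij]), rfl, rfl⟩
      · rintro ⟨i, j, hne, rfl, rfl⟩
        exact ⟨⟨i, rfl⟩, ⟨j, rfl⟩, hinj.ne hne⟩
    rw [hoff, Finset.sum_image (Function.Injective.injOn (hinj.prodMap hinj))]
    have hterm : ∀ q ∈ (Finset.univ : Finset ((Fin k × Bool) ⊕ Fin s)).offDiag,
        Real.exp (2 * c * inner ℝ (Prod.map p p q).1 (Prod.map p p q).2) ≤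
          (if crossRel q.1 q.2 then 1 else 0) * Real.exp (2 * c * h ^ 2) +
            Real.exp (2 * c * (-(h * δ))) := by
      rintro ⟨x, y⟩ hq
      have h1 := hbound x y (Finset.mem_offDiag.1 hq).2.2
      simp only [Prod.map_apply]
      split_ifs at h1 ⊢ with hc'
      · have := Real.exp_le_exp.2 (mul_le_mul_of_nonneg_left h1 (by positivity : 0 ≤ 2 * c))
        have := Real.exp_pos (2 * c * (-(h * δ)))
        linarith
      · have := Real.exp_le_exp.2 (mul_le_mul_of_nonneg_left h1 (by positivity : 0 ≤ 2 * c))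
        linarith
    refine (Finset.sum_le_sum hterm).trans ?_
    refine (Finset.sum_le_sum_of_subset_of_nonneg (Finset.subset_univ _) fun q _ _ => ?_).trans ?_
    · split_ifs <;> positivity
    · rw [Fintype.sum_prod_type]
      simp only [Finset.sum_add_distrib, ← Finset.sum_mul, sum_crossRel]
      simp only [Finset.sum_const, Finset.card_univ, Fintype.card_sum, Fintype.card_prod,
        Fintype.card_fin, Fintype.card_bool, nsmul_eq_mul]
      push_cast
      apply le_of_eq
      ring

end Competitor

/-! ### Universally optimal configurations -/

open Classical in
/-- In a universally optimal configuration all inner products of distinct points are nonpositive,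
and the number of orthogonal pairs is at most that of the limit of the competing configurations. -/
theorem IsUniversallyOptimal.inner_nonpos_and_card_orthogonalPairs_le {n k s : ℕ} (hs : 0 < s)
    (hn : n = k + s) {C : Finset (EuclideanSpace ℝ (Fin n))} (hC : IsUniversallyOptimal C)
    (hcard : C.card = 2 * k + s) :
    (∀ x ∈ C, ∀ y ∈ C, x ≠ y → inner ℝ x y ≤ 0) ∧
      ((orthogonalPairs C).card : ℝ) ≤ 4 * k * (k - 1) := by
  subst hn
  obtain ⟨δ, hδ, hcomp⟩ := exists_competitor hs
    ((EuclideanSpace.basisFun (Fin (k + s)) ℝ).orthonormal.comp finSumFinEquiv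
      finSumFinEquiv.injective)
  -- With `c = t ^ 3` and `h = 1 / t ^ 2`, `c * h ^ 2` tends to `0` while `c * h` tends to infinity.
  have hmain : ∀ t : ℝ, 2 ≤ t →
      ∑ p ∈ C.offDiag, Real.exp (2 * t ^ 3 * inner ℝ p.1 p.2) ≤
        4 * k * (k - 1) * Real.exp (2 * t⁻¹) + (2 * k + s) ^ 2 * Real.exp (-(2 * δ * t)) := by
    intro t ht
    have ht0 : 0 < t := by linarith
    obtain ⟨C', hC'card, hC'sph, hC'⟩ := hcomp (1 / t ^ 2) (by positivity)
      (one_div_le_one_div_of_le (by norm_num) (by nlinarith))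
    refine (hC.sum_exp_le hC'sph (hC'card.trans hcard.symm) (by positivity)).trans
      ((hC' (t ^ 3) (by positivity)).trans (le_of_eq ?_))
    congr 3
    · field_simp
    · field_simp
  have hlim : Filter.Tendsto (fun t : ℝ => 4 * k * (k - 1) * Real.exp (2 * t⁻¹) +
      (2 * k + s) ^ 2 * Real.exp (-(2 * δ * t))) Filter.atTop
      (nhds (4 * (k : ℝ) * (k - 1))) := by
    have h1 : Filter.Tendsto (fun t : ℝ => Real.exp (2 * t⁻¹)) Filter.atTop (nhds 1) := by
      have := (Real.continuous_exp.tendsto (2 * 0)).comp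
        ((tendsto_inv_atTop_zero (𝕜 := ℝ)).const_mul 2)
      simpa [Function.comp_def] using this
    have h2 : Filter.Tendsto (fun t : ℝ => Real.exp (-(2 * δ * t))) Filter.atTop (nhds 0) :=
      Real.tendsto_exp_neg_atTop_nhds_zero.comp
        (Filter.tendsto_id.const_mul_atTop (by positivity))
    have := (h1.const_mul (4 * (k : ℝ) * (k - 1))).add (h2.const_mul ((2 * (k : ℝ) + s) ^ 2))
    simpa using this
  constructor
  · intro x hx y hy hne
    by_contra! hpos
    have htop : Filter.Tendsto (fun t : ℝ => Real.exp (2 * t ^ 3 * inner ℝ x y))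
        Filter.atTop Filter.atTop := by
      refine Real.tendsto_exp_atTop.comp ?_
      refine Filter.Tendsto.atTop_mul_const hpos ?_
      exact (Filter.tendsto_pow_atTop (by norm_num)).const_mul_atTop (by norm_num)
    refine not_tendsto_atTop_of_tendsto_nhds hlim (Filter.tendsto_atTop_mono' _ ?_ htop)
    filter_upwards [Filter.eventually_ge_atTop 2] with t ht
    refine le_trans ?_ (hmain t ht)
    exact Finset.single_le_sum
      (f := fun p : EuclideanSpace ℝ (Fin (k + s)) × EuclideanSpace ℝ (Fin (k + s)) =>
        Real.exp (2 * t ^ 3 * inner ℝ p.1 p.2)) (fun p _ => (Real.exp_pos _).le)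
      (Finset.mem_offDiag.2 ⟨hx, hy, hne⟩ : (x, y) ∈ C.offDiag)
  · refine ge_of_tendsto hlim ?_
    filter_upwards [Filter.eventually_ge_atTop 2] with t ht
    refine le_trans ?_ (hmain t ht)
    have hsub : orthogonalPairs C ⊆ C.offDiag := Finset.filter_subset _ _
    refine le_trans (le_of_eq ?_)
      (Finset.sum_le_sum_of_subset_of_nonneg hsub fun p _ _ => (Real.exp_pos _).le)
    rw [Finset.card_eq_sum_ones, Nat.cast_sum]
    refine Finset.sum_congr rfl fun p hp => ?_
    rw [(Finset.mem_filter.1 hp).2]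
    simp

theorem proposition1p4 (n N : ℕ) (hN₁ : n + 1 < N) (hN₂ : N < 2 * n) :
    ¬ ∃ C : Finset (EuclideanSpace ℝ (Fin n)), C.card = N ∧ IsUniversallyOptimal C := by
  rintro ⟨C, hcard, hC⟩
  obtain ⟨k, rfl⟩ : ∃ k, N = n + k := ⟨N - n, by omega⟩
  obtain ⟨s, rfl⟩ : ∃ s, n = k + s := ⟨n - k, by omega⟩
  have hs : 0 < s := by omega
  have hk : 2 ≤ k := by omega
  obtain ⟨hobt, hle⟩ :=
    hC.inner_nonpos_and_card_orthogonalPairs_le hs rfl (by omega)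
  have h0 : (0 : EuclideanSpace ℝ (Fin (k + s))) ∉ C := by
    intro h
    simpa using hC.1 h
  -- Here `4 * (k - 1) * n` pairs exceed `4 * k * (k - 1)`, since `k ≥ 2` and `s > 0`.
  have hge := (card_le_and_le_card_orthogonalPairs ⊤ C (by simp) h0 hobt).2
  rw [finrank_top, finrank_euclideanSpace_fin, hcard] at hge
  have hge' : (4 * (((k + s + k : ℕ) : ℝ) - (k + s : ℕ) - 1) * (k + s : ℕ) : ℝ) ≤
      (orthogonalPairs C).card := by exact_mod_cast hge
  push_cast at hge'
  have hs' : (1 : ℝ) ≤ s := by exact_mod_cast hs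
  have hk' : (2 : ℝ) ≤ k := by exact_mod_cast hk
  nlinarith
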